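/- Let $\Bbbk$ be an algebraically closed field of characteristic zero, $A$ a Hopf algebra over $\Bbbk$, $\sigma$ an algebra automorphism of $A$, and $A[x,\sigma]$ the Ore extension with $xa=\sigma(a)x$ for $a\in A$. Suppose $A[x,\sigma]$ is a Hopf-Ore extension of $A$, i.e. it carries a Hopf algebra structure extending that of $A$ and such that $\Delta(x)=x\otimes 1+g\otimes x$ for a grouplike element $g\in A$. Let $\chi=\varepsilon\circ\sigma:A\to\Bbbk$ be its character, so that $\sigma(a)=\chi(a_1)a_2$ for all $a\in A$. Let $d\ge 1$ and assume that $q=\chi(g)$ is a primitive $d$-th root of unity, that $g^d$ lies in the centre of $A$, and that $\chi^d=1$ (i.e. $\chi^d=\varepsilon$ for the convolution product). Let $R$ be a unital associative $\Bbbk$-algebra and $\cdot:A[x,\sigma]\otimes R\to R$ a (left) partial action, i.e. a linear map such that $1\cdot r=r$, $h\cdot(rs)=(h_1\cdot r)(h_2\cdot s)$ and $h\cdot(l\cdot r)=(h_1\cdot 1_R)(h_2l\cdot r)$ for all $h,l\in A[x,\sigma]$ and $r,s\in R$. Assume that one of the following holds: (i) $g\cdot 1_R=1_R$ and $(x^d+g^d)\cdot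 r=r$ for all $r\in R$; or (ii) $g\cdot 1_R=0$, $g^d\cdot 1_R=1_R$ and $[(x\cdot 1_R)^d-1_R]\,r=(g^d\cdot r)\,[(x\cdot 1_R)^d-1_R]$ for all $r\in R$. Then the two-sided ideal $I=\langle x^d+g^d-1\rangle$ of $A[x,\sigma]$ is a Hopf ideal, $h\cdot r=0$ for all $h\in I$ and $r\in R$, and there is a unique partial action of the quotient Hopf algebra $A[x,\sigma]/I$ on $R$ such that $\bar h\cdot r=h\cdot r$ for all $h\in A[x,\sigma]$ and $r\in R$, where $\bar h$ is the class of $h$. -/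

import Mathlib

open scoped TensorProduct

noncomputable section

/-! ### Ore extensions of automorphism type -/

section OreExtension

variable {k A : Type*} [Field k] [Ring A] [Algebra k A]

/-- The action of the monoid `ℕ` on `A` by the powers of `σ`: `n • a = σⁿ(a)`. -/
abbrev oreAction (σ : A ≃ₐ[k] A) : MulSemiringAction (Multiplicative ℕ) A :=
  MulSemiringAction.compHom A (powersHom (A ≃ₐ[k] A) σ)

/-- The Ore extension `A[x, σ] = A[x, σ, 0]`: the skew polynomials `∑ aᵢ xⁱ` with coefficients in
`A`, multiplied by the rule `x a = σ(a) x`.  Only the ring structure is registered here; the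
`k`-algebra structure is part of the Hopf algebra structures considered on it. -/
def OreExtension (_σ : A ≃ₐ[k] A) : Type _ := SkewPolynomial A

namespace OreExtension

variable (σ : A ≃ₐ[k] A)

instance : Ring (OreExtension σ) :=
  letI := oreAction σ
  inferInstanceAs (Ring (SkewPolynomial A))

/-- The inclusion of the coefficient ring `A` in `A[x, σ]`. -/
def C : A →+* OreExtension σ :=
  letI := oreAction σ
  (SkewPolynomial.CRingHom : A →+* SkewPolynomial A)

/-- The variable `x` of `A[x, σ]`. -/
def X : OreExtension σ := (SkewPolynomial.X : SkewPolynomial A)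

/-- The defining relation `x a = σ(a) x`. -/
theorem X_mul_C (a : A) : X σ * C σ a = C σ (σ a) * X σ := by
  let := oreAction σ
  have h : (SkewPolynomial.X : SkewPolynomial A) * SkewPolynomial.monomial 0 a
      = SkewPolynomial.C (σ a) * SkewPolynomial.X := by
    rw [SkewPolynomial.X_mul_monomial, ← SkewPolynomial.monomial_one_one_eq_X,
      SkewPolynomial.C_mul_monomial, mul_one]
    rfl
  exact h

/-- Every element of `A[x, σ]` is uniquely of the form `∑ aᵢ xⁱ`. -/
theorem existsUnique_eq_sum (p : OreExtension σ) :
    ∃! f : ℕ →₀ A, p = f.sum fun i a => C σ a * X σ ^ i := by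
  let := oreAction σ
  have key : ∀ f : ℕ →₀ A, (f.sum fun i a => C σ a * X σ ^ i)
      = (SkewMonoidAlgebra.ofCoeff (f.mapDomain Multiplicative.ofAdd) : SkewPolynomial A) := by
    intro f
    induction f using Finsupp.induction_linear with
    | zero => simp; rfl
    | add f g hf hg =>
      rw [Finsupp.sum_add_index' (by simp) (by intros; rw [map_add, add_mul]), hf, hg,
        Finsupp.mapDomain_add, SkewMonoidAlgebra.ofCoeff_add]
      rfl
    | single i a =>
      rw [Finsupp.sum_single_index (by simp), Finsupp.mapDomain_single]
      have h : (SkewPolynomial.C a : SkewPolynomial A) * SkewPolynomial.X ^ i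
          = SkewPolynomial.monomial i a := by
        rw [← SkewPolynomial.monomial_one_right_eq_X_pow, SkewPolynomial.C_mul_monomial, mul_one]
      exact h
  have hinj : Function.Injective
      (Finsupp.mapDomain (M := A) (Multiplicative.ofAdd : ℕ → Multiplicative ℕ)) :=
    Finsupp.mapDomain_injective Multiplicative.ofAdd.injective
  refine ⟨(SkewMonoidAlgebra.coeff (G := Multiplicative ℕ) p).mapDomain Multiplicative.toAdd,
    ?_, ?_⟩
  · change p = _
    rw [key, ← Finsupp.mapDomain_comp]
    have : (Multiplicative.ofAdd : ℕ → Multiplicative ℕ) ∘ Multiplicative.toAdd = id := rfl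
    rw [this, Finsupp.mapDomain_id]
    rfl
  · intro f hf
    replace hf := hf.trans (key f)
    subst hf
    change f = (f.mapDomain Multiplicative.ofAdd).mapDomain Multiplicative.toAdd
    rw [← Finsupp.mapDomain_comp]
    exact Finsupp.mapDomain_id.symm

end OreExtension

end OreExtension

/-! ### Hopf-Ore extensions -/

section HopfOre

variable {k A : Type*} [Field k] [Ring A] [HopfAlgebra k A]

/-- A Hopf algebra structure on the ring `A[x, σ]` makes it a *Hopf-Ore extension* of `A`, with
grouplike element `g ∈ G(A)`, if it extends the Hopf algebra structure of `A` and
`Δ(x) = x ⊗ 1 + g ⊗ x`. (A bialgebra homomorphism of Hopf algebras respects the antipodes.) -/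
structure IsHopfOreExtension (σ : A ≃ₐ[k] A) (g : A) [HopfAlgebra k (OreExtension σ)] :
    Prop where
  isGroupLikeElem : IsGroupLikeElem k g
  exists_bialgHom : ∃ ι : A →ₐc[k] OreExtension σ, ∀ a, ι a = OreExtension.C σ a
  comul_X : Coalgebra.comul (R := k) (OreExtension.X σ)
    = OreExtension.X σ ⊗ₜ[k] 1 + OreExtension.C σ g ⊗ₜ[k] OreExtension.X σ

/-- The character `χ : A → k` of a Hopf-Ore extension, for which `σ(a) = χ(a₁) a₂`. Applying the
counit to this equation gives `χ = ε ∘ σ`. -/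
def oreCharacter (σ : A ≃ₐ[k] A) : A →ₐ[k] k :=
  (Bialgebra.counitAlgHom k A).comp (σ : A →ₐ[k] A)

/-- A character `χ` with `σ(a) = χ(a₁) a₂` for all `a` is `oreCharacter σ`. -/
theorem eq_oreCharacter (σ : A ≃ₐ[k] A) (χ : A →ₐ[k] k)
    (hχ : ∀ a, σ a = TensorProduct.lid k A
      (TensorProduct.map χ.toLinearMap LinearMap.id (Coalgebra.comul (R := k) a))) :
    χ = oreCharacter σ := by
  ext a
  have hr := Coalgebra.Repr.arbitrary k a
  have h1 : oreCharacter σ a = Coalgebra.counit (R := k) (σ a) := rfl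
  rw [h1, hχ a, ← hr.eq]
  have h2 := congrArg (TensorProduct.rid k k) (congrArg (TensorProduct.map χ.toLinearMap
    (LinearMap.id (R := k) (M := k))) (Coalgebra.sum_tmul_counit_eq hr))
  simp only [map_sum, TensorProduct.map_tmul, TensorProduct.rid_tmul, LinearMap.id_apply,
    AlgHom.toLinearMap_apply, TensorProduct.lid_tmul, map_smul, smul_eq_mul, one_mul] at h2 ⊢
  rw [← h2]
  exact Finset.sum_congr rfl fun _ _ => mul_comm _ _

end HopfOre

/-! ### Partial actions -/

/-- A (left) partial action of a bialgebra `H` on a unital algebra `R`: a bilinear map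
`(h, r) ↦ h · r` satisfying the axioms below, where `Δ(h) = h₁ ⊗ h₂`. -/
@[ext]
structure PartialAction (k H R : Type*) [Field k] [Ring H] [Bialgebra k H] [Ring R]
    [Algebra k R] where
  /-- The map `(h, r) ↦ h · r`. -/
  act : H →ₗ[k] R →ₗ[k] R
  /-- `1 · r = r`. -/
  one_act : ∀ r, act 1 r = r
  /-- `h · (r s) = (h₁ · r) (h₂ · s)`. -/
  act_mul : ∀ h r s, act h (r * s) =
    LinearMap.mul' k R (TensorProduct.map (act.flip r) (act.flip s) (Coalgebra.comul (R := k) h))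
  /-- `h · (l · r) = (h₁ · 1) (h₂ l · r)`. -/
  act_act : ∀ h l r, act h (act l r) =
    LinearMap.mul' k R (TensorProduct.map (act.flip 1) (act.flip r ∘ₗ LinearMap.mulRight k l)
      (Coalgebra.comul (R := k) h))

end

/-! Put w = xᵈ + gᵈ - 1. Since (x ⊗ 1)(g ⊗ x) = q (g ⊗ x)(x ⊗ 1) and q is a primitive d-th root of
unity, the q-binomial theorem gives Δ(xᵈ) = xᵈ ⊗ 1 + gᵈ ⊗ xᵈ, so w is skew-primitive. It is also
central: χᵈ = ε forces σᵈ = 1, gᵈ is central in A, and x gᵈ = qᵈ gᵈ x = gᵈ x. Hence I = w A[x, σ],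
and both the Hopf ideal axioms and the vanishing of I on R need only be checked on multiples w c. As
gᵈ · 1 = 1, expanding w · (c · r) shows that w c kills R once w does
(`act_mul_eq_zero_of_comul_eq`). In case (i), w kills R by hypothesis. In case (ii), g · 1 = 0
forces xᵈ · r = yᵈ r - (gᵈ · r) yᵈ with y = x · 1 (`act_pow_add_act_pow_mul`), which turns the
hypothesis into w · r = 0. The action then descends to the quotient. -/

/-! ### The `q`-binomial theorem -/

section QBinomial

/-- The Gaussian binomial coefficients, given by the Pascal recursion. -/
def gaussBinom {k : Type*} [CommRing k] (q : k) : ℕ → ℕ → k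
  | _, 0 => 1
  | 0, _ + 1 => 0
  | n + 1, i + 1 => gaussBinom q n i + q ^ (i + 1) * gaussBinom q n (i + 1)

variable {k B : Type*} [CommRing k]

@[simp]
theorem gaussBinom_zero_right (q : k) (n : ℕ) : gaussBinom q n 0 = 1 := by
  cases n <;> rfl

theorem gaussBinom_succ_succ (q : k) (n i : ℕ) : gaussBinom q (n + 1) (i + 1) =
    gaussBinom q n i + q ^ (i + 1) * gaussBinom q n (i + 1) := rfl

theorem gaussBinom_eq_zero_of_lt (q : k) {n i : ℕ} (h : n < i) : gaussBinom q n i = 0 := by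
  induction n generalizing i with
  | zero => obtain ⟨i, rfl⟩ := Nat.exists_eq_succ_of_ne_zero h.ne'; rfl
  | succ n ih =>
    obtain ⟨i, rfl⟩ := Nat.exists_eq_succ_of_ne_zero (Nat.ne_zero_of_lt h)
    rw [Nat.succ_eq_add_one, gaussBinom_succ_succ, ih (by omega), ih (by omega), mul_zero, add_zero]

@[simp]
theorem gaussBinom_self (q : k) (n : ℕ) : gaussBinom q n n = 1 := by
  induction n with
  | zero => rfl
  | succ n ih => rw [gaussBinom_succ_succ, ih, gaussBinom_eq_zero_of_lt q n.lt_succ_self,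
      mul_zero, add_zero]

/-- This absorption identity yields vanishing at roots of unity without dividing by q-factorials:
for n + 1 = d the right side is zero, while 1 - q ^ (i + 1) is not when i + 1 < d. -/
theorem one_sub_pow_mul_gaussBinom (q : k) (n i : ℕ) :
    (1 - q ^ (i + 1)) * gaussBinom q (n + 1) (i + 1) = (1 - q ^ (n + 1)) * gaussBinom q n i := by
  induction n generalizing i with
  | zero =>
    cases i with
    | zero => simp
    | succ i => simp [gaussBinom_eq_zero_of_lt]
  | succ n ih =>
    rw [gaussBinom_succ_succ q (n + 1) i, mul_add, mul_left_comm, ih i]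
    cases i with
    | zero => simp only [gaussBinom_zero_right]; ring
    | succ j =>
      have h1 := ih j
      have h2 := gaussBinom_succ_succ q n j
      linear_combination q * h1 - q * (1 - q ^ (n + 1)) * h2

theorem gaussBinom_eq_zero_of_isPrimitiveRoot [IsDomain k] {q : k} {d i : ℕ}
    (hq : IsPrimitiveRoot q d) (hi : 0 < i) (hid : i < d) : gaussBinom q d i = 0 := by
  obtain ⟨i, rfl⟩ := Nat.exists_eq_succ_of_ne_zero hi.ne'
  obtain ⟨d, rfl⟩ := Nat.exists_eq_succ_of_ne_zero (Nat.ne_zero_of_lt hid)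
  have h := one_sub_pow_mul_gaussBinom q d i
  rw [hq.pow_eq_one, sub_self, zero_mul] at h
  exact (mul_eq_zero.mp h).resolve_left
    (sub_ne_zero.mpr (hq.pow_ne_one_of_pos_of_lt (Nat.succ_ne_zero i) hid).symm)

variable [Ring B] [Algebra k B]

theorem mul_pow_eq_smul_of_mul_eq_smul {q : k} {a b : B} (h : a * b = q • (b * a)) (n : ℕ) :
    a * b ^ n = q ^ n • (b ^ n * a) := by
  induction n with
  | zero => simp
  | succ n ih =>
    rw [pow_succ, ← mul_assoc, ih, smul_mul_assoc, mul_assoc, h, mul_smul_comm, smul_smul,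
      ← pow_succ, mul_assoc]

/-- The `q`-binomial theorem. -/
theorem add_pow_eq_sum_gaussBinom {q : k} {a b : B} (h : a * b = q • (b * a)) (n : ℕ) :
    (a + b) ^ n =
      ∑ p ∈ Finset.HasAntidiagonal.antidiagonal n, gaussBinom q n p.1 • (b ^ p.1 * a ^ p.2) := by
  induction n with
  | zero => simp
  | succ n ih =>
    have h1 : a * (a + b) ^ n = a ^ (n + 1) + ∑ p ∈ Finset.HasAntidiagonal.antidiagonal n,
        (q ^ (p.1 + 1) * gaussBinom q n (p.1 + 1)) • (b ^ (p.1 + 1) * a ^ p.2) := by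
      -- The same sum over the antidiagonal of n + 1 is split at either end; the term with index n +
      -- 1 vanishes, since the Gaussian binomial is taken at n.
      have e1 := Finset.Nat.sum_antidiagonal_succ (n := n)
        (f := fun p => (q ^ p.1 * gaussBinom q n p.1) • (b ^ p.1 * a ^ p.2))
      have e2 := Finset.Nat.sum_antidiagonal_succ' (n := n)
        (f := fun p => (q ^ p.1 * gaussBinom q n p.1) • (b ^ p.1 * a ^ p.2))
      simp only [gaussBinom_eq_zero_of_lt q n.lt_succ_self, mul_zero, zero_smul, zero_add,
        pow_zero, gaussBinom_zero_right, one_mul, one_smul] at e1 e2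
      rw [← e1, e2, ih, Finset.mul_sum]
      refine Finset.sum_congr rfl fun p _ => ?_
      rw [mul_smul_comm, ← mul_assoc, mul_pow_eq_smul_of_mul_eq_smul h, smul_mul_assoc,
        smul_smul, mul_assoc, ← pow_succ', mul_comm (q ^ p.1)]
    rw [pow_succ', add_mul, h1, ih, Finset.mul_sum, Finset.Nat.sum_antidiagonal_succ]
    simp only [gaussBinom_succ_succ, gaussBinom_zero_right, pow_zero, one_mul, one_smul, add_assoc]
    rw [← Finset.sum_add_distrib]
    congr 1
    refine Finset.sum_congr rfl fun p _ => ?_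
    rw [mul_smul_comm, ← mul_assoc, ← pow_succ', add_smul, add_comm]

theorem add_pow_eq_of_isPrimitiveRoot [IsDomain k] {q : k} {d : ℕ} (hd : 0 < d)
    (hq : IsPrimitiveRoot q d) {a b : B} (h : a * b = q • (b * a)) :
    (a + b) ^ d = a ^ d + b ^ d := by
  rw [add_pow_eq_sum_gaussBinom h]
  have h0 : ((0, d) : ℕ × ℕ) ≠ (d, 0) := by simp [hd.ne]
  rw [← Finset.sum_subset (s₁ := {(0, d), (d, 0)}), Finset.sum_pair h0]
  · simp
  · intro p hp
    simp only [Finset.mem_insert, Finset.mem_singleton] at hp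
    rcases hp with rfl | rfl <;> simp
  · rintro ⟨i, j⟩ hp hn
    simp only [Finset.HasAntidiagonal.mem_antidiagonal, Finset.mem_insert, Finset.mem_singleton,
      Prod.mk.injEq, not_or] at hp hn
    rw [gaussBinom_eq_zero_of_isPrimitiveRoot hq (by omega) (by omega), zero_smul]

end QBinomial

/-! ### Skew-primitive elements -/

section SkewPrimitive

variable {k H : Type*} [Field k] [Ring H]

theorem counit_eq_zero_of_comul_eq [Bialgebra k H] {g x : H} (hg : IsGroupLikeElem k g)
    (hx : Coalgebra.comul (R := k) x = x ⊗ₜ[k] 1 + g ⊗ₜ[k] x) :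
    Coalgebra.counit (R := k) x = 0 := by
  have h := congrArg (TensorProduct.lid k H) (Coalgebra.rTensor_counit_comul (R := k) x)
  rw [hx] at h
  simp only [map_add, LinearMap.rTensor_tmul, TensorProduct.lid_tmul, hg.counit_eq_one, one_smul,
    add_eq_right] at h
  have h2 := congrArg (Coalgebra.counit (R := k)) h
  simpa using h2

/-- Multiplying out (S ⊗ id)Δ(x) gives S(x) + S(g) x = ε(x) = 0. Keeping x as the right factor makes
S(x) visibly a member of any left ideal containing x. -/
theorem antipode_eq_of_comul_eq [HopfAlgebra k H] {g x : H} (hg : IsGroupLikeElem k g)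
    (hx : Coalgebra.comul (R := k) x = x ⊗ₜ[k] 1 + g ⊗ₜ[k] x) :
    HopfAlgebra.antipode k x = -(HopfAlgebra.antipode k g * x) := by
  have h := HopfAlgebra.mul_antipode_rTensor_comul_apply (R := k) x
  rw [hx, counit_eq_zero_of_comul_eq hg hx] at h
  simp only [map_add, LinearMap.rTensor_tmul, LinearMap.mul'_apply, mul_one, map_zero] at h
  exact eq_neg_of_add_eq_zero_left h

/-- A sufficient condition for an ideal consisting of the multiples of a skew-primitive element
to be a Hopf ideal. -/
theorem isHopfIdeal_of_forall_exists_mul [HopfAlgebra k H] {g w : H} (hg : IsGroupLikeElem k g)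
    (hw : Coalgebra.comul (R := k) w = w ⊗ₜ[k] 1 + g ⊗ₜ[k] w) (I : Ideal H) [I.IsTwoSided]
    (hwI : w ∈ I) (hI : ∀ h ∈ I, ∃ c, h = w * c) : I.IsHopfIdeal k where
  counit_eq_zero h hh := by
    obtain ⟨c, rfl⟩ := hI h hh
    rw [Bialgebra.counit_mul, counit_eq_zero_of_comul_eq hg hw, zero_mul]
  map_mkQ_comul_eq_zero h hh := by
    obtain ⟨c, rfl⟩ := hI h hh
    change Algebra.TensorProduct.map (Ideal.Quotient.mkₐ k I) (Ideal.Quotient.mkₐ k I)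
      (Coalgebra.comul (R := k) (w * c)) = 0
    have h0 : Ideal.Quotient.mkₐ k I w = 0 := Ideal.Quotient.eq_zero_iff_mem.mpr hwI
    rw [Bialgebra.comul_mul, map_mul, hw, map_add, Algebra.TensorProduct.map_tmul,
      Algebra.TensorProduct.map_tmul, h0, TensorProduct.zero_tmul, TensorProduct.tmul_zero,
      add_zero, zero_mul]
  antipode_mem h hh := by
    obtain ⟨c, rfl⟩ := hI h hh
    rw [HopfAlgebra.antipode_mul_antidistrib, antipode_eq_of_comul_eq hg hw]
    exact I.mul_mem_left _ (I.neg_mem (I.mul_mem_left _ hwI))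

theorem exists_eq_mul_of_mem_span_singleton {w : H} (hw : w ∈ Set.center H) {h : H}
    (hh : h ∈ TwoSidedIdeal.span {w}) : ∃ c, h = w * c := by
  have hc : ∀ x, w * x = x * w := fun x => (Set.mem_center_iff.mp hw).comm x
  induction hh using TwoSidedIdeal.span_induction with
  | mem x hx => exact ⟨1, by rw [hx, mul_one]⟩
  | zero => exact ⟨0, (mul_zero w).symm⟩
  | add x y _ _ hx hy =>
    obtain ⟨⟨a, rfl⟩, b, rfl⟩ := And.intro hx hy
    exact ⟨a + b, (mul_add w a b).symm⟩
  | neg x _ hx =>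
    obtain ⟨a, rfl⟩ := hx
    exact ⟨-a, (mul_neg w a).symm⟩
  | left_absorb a x _ hx =>
    obtain ⟨b, rfl⟩ := hx
    exact ⟨a * b, by rw [← mul_assoc, ← hc a, mul_assoc]⟩
  | right_absorb a x _ hx =>
    obtain ⟨b, rfl⟩ := hx
    exact ⟨b * a, mul_assoc w b a⟩

end SkewPrimitive

/-! ### Structure of Hopf-Ore extensions -/

namespace OreExtension

section Coeff

variable {k A : Type*} [Field k] [Ring A] [Algebra k A] (σ : A ≃ₐ[k] A)

theorem X_mul_C_pow (a : A) (n : ℕ) : X σ ^ n * C σ a = C σ ((σ ^ n) a) * X σ ^ n := by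
  induction n generalizing a with
  | zero => simp
  | succ n ih => rw [pow_succ, mul_assoc, X_mul_C, ← mul_assoc, ih, mul_assoc, pow_succ]; rfl

theorem induction_on {motive : OreExtension σ → Prop} (p : OreExtension σ)
    (add : ∀ p q, motive p → motive q → motive (p + q))
    (monomial : ∀ a n, motive (C σ a * X σ ^ n)) : motive p := by
  obtain ⟨f, rfl, -⟩ := existsUnique_eq_sum σ p
  induction f using Finsupp.induction_linear with
  | zero => simpa using monomial 0 0
  | add f g hf hg =>
    rw [Finsupp.sum_add_index' (by simp) (by intros; rw [map_add, add_mul])]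
    exact add _ _ hf hg
  | single i a =>
    rw [Finsupp.sum_single_index (by simp)]
    exact monomial a i

/-- The coefficient of `xⁿ`, as an additive map. -/
def coeffAddHom (n : ℕ) : OreExtension σ →+ A where
  toFun p := SkewMonoidAlgebra.coeff (G := Multiplicative ℕ) p (Multiplicative.ofAdd n)
  map_zero' := rfl
  map_add' p q := congrArg (fun f => f (Multiplicative.ofAdd n))
    (SkewMonoidAlgebra.coeff_add (k := A) (G := Multiplicative ℕ) p q)

theorem coeffAddHom_C_mul_X_pow (n m : ℕ) (a : A) :
    coeffAddHom σ n (C σ a * X σ ^ m) = if m = n then a else 0 := by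
  let := oreAction σ
  have h : (SkewPolynomial.C a : SkewPolynomial A) * SkewPolynomial.X ^ m
      = SkewPolynomial.monomial m a := by
    rw [← SkewPolynomial.monomial_one_right_eq_X_pow, SkewPolynomial.C_mul_monomial, mul_one]
  exact (congrArg (fun p => SkewPolynomial.coeff p n) h).trans SkewPolynomial.coeff_monomial

theorem coeffAddHom_C_mul (n : ℕ) (a : A) (p : OreExtension σ) :
    coeffAddHom σ n (C σ a * p) = a * coeffAddHom σ n p := by
  induction p using induction_on σ with
  | add p q hp hq => rw [mul_add, map_add, map_add, hp, hq, mul_add]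
  | monomial b m => rw [← mul_assoc, ← map_mul, coeffAddHom_C_mul_X_pow, coeffAddHom_C_mul_X_pow,
      mul_ite, mul_zero]

end Coeff

end OreExtension

section HopfOre

variable {k A : Type*} [Field k] [Ring A] [HopfAlgebra k A]

theorem oreCharacter_apply (σ : A ≃ₐ[k] A) (a : A) :
    oreCharacter σ a = Coalgebra.counit (R := k) (σ a) := rfl

/-- If `σ(a) = χ(a₁) a₂`, then the powers of `χ` are given by `χⁿ = ε ∘ σⁿ`. -/
theorem toConv_oreCharacter_pow_apply {σ : A ≃ₐ[k] A}
    (hσ : ∀ a, Coalgebra.comul (R := k) (σ a) =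
      σ.toLinearMap.rTensor A (Coalgebra.comul (R := k) a)) (n : ℕ) (a : A) :
    (WithConv.toConv (oreCharacter σ) ^ n) a = Coalgebra.counit (R := k) ((σ ^ n) a) := by
  induction n generalizing a with
  | zero => rw [pow_zero, pow_zero]; rfl
  | succ n ih =>
    have hr := Coalgebra.Repr.arbitrary k a
    have h := Coalgebra.rTensor_counit_comul (R := k) (σ a)
    rw [hσ, ← hr.eq] at h
    have h2 := congrArg (TensorProduct.lid k A) h
    simp only [map_sum, LinearMap.rTensor_tmul, TensorProduct.lid_tmul, one_smul,
      AlgEquiv.toLinearMap_apply] at h2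
    have h3 : (σ ^ (n + 1)) a = (σ ^ n) (σ a) := by rw [pow_succ]; rfl
    rw [h3, ← h2, pow_succ', AlgHom.convMul_apply, ← hr.eq]
    simp only [map_sum, Algebra.TensorProduct.lift_tmul, map_smul, smul_eq_mul, oreCharacter_apply,
      ih]

/-- Every σⁿ is determined by its character ε ∘ σⁿ, because σⁿ = ((ε ∘ σⁿ) ⊗ id)Δ; for n = d this
character is χᵈ = ε. -/
theorem pow_eq_one_of_toConv_oreCharacter_pow_eq_one {σ : A ≃ₐ[k] A}
    (hσ : ∀ a, Coalgebra.comul (R := k) (σ a) =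
      σ.toLinearMap.rTensor A (Coalgebra.comul (R := k) a)) {d : ℕ}
    (hχ : WithConv.toConv (oreCharacter σ) ^ d = 1) : σ ^ d = 1 := by
  have hσn : ∀ n a, Coalgebra.comul (R := k) ((σ ^ n) a) =
      (σ ^ n).toLinearMap.rTensor A (Coalgebra.comul (R := k) a) := by
    intro n
    induction n with
    | zero => intro a; exact (LinearMap.congr_fun (LinearMap.rTensor_id A A) _).symm
    | succ n ih =>
      intro a
      have h3 : (σ ^ (n + 1)).toLinearMap = (σ ^ n).toLinearMap ∘ₗ σ.toLinearMap := by
        rw [pow_succ]; rfl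
      have h4 : (σ ^ (n + 1)) a = (σ ^ n) (σ a) := by rw [pow_succ]; rfl
      rw [h4, ih, hσ, h3, LinearMap.rTensor_comp_apply]
  ext a
  have h := Coalgebra.rTensor_counit_comul (R := k) ((σ ^ d) a)
  rw [hσn, ← LinearMap.rTensor_comp_apply] at h
  have h1 : Coalgebra.counit (R := k) ∘ₗ (σ ^ d).toLinearMap = Coalgebra.counit (A := A) := by
    ext b
    have := toConv_oreCharacter_pow_apply hσ d b
    rw [hχ] at this
    exact this.symm
  rw [h1, Coalgebra.rTensor_counit_comul] at h
  simpa using (congrArg (TensorProduct.lid k A) h).symm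

namespace IsHopfOreExtension

variable {σ : A ≃ₐ[k] A} {g : A} [HopfAlgebra k (OreExtension σ)]

open OreExtension

theorem isGroupLikeElem_C (hH : IsHopfOreExtension σ g) : IsGroupLikeElem k (C σ g) := by
  obtain ⟨ι, hι⟩ := hH.exists_bialgHom
  exact hι g ▸ hH.isGroupLikeElem.map ι

theorem C_smul (hH : IsHopfOreExtension σ g) (c : k) (a : A) : C σ (c • a) = c • C σ a := by
  obtain ⟨ι, hι⟩ := hH.exists_bialgHom
  rw [← hι, ← hι, map_smul]

theorem comul_C (hH : IsHopfOreExtension σ g) (a : A) : Coalgebra.comul (R := k) (C σ a) =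
    ∑ i ∈ (Coalgebra.Repr.arbitrary k a).index,
      C σ ((Coalgebra.Repr.arbitrary k a).left i) ⊗ₜ[k]
        C σ ((Coalgebra.Repr.arbitrary k a).right i) := by
  obtain ⟨ι, hι⟩ := hH.exists_bialgHom
  have := CoalgHomClass.map_comp_comul_apply (R := k) ι a
  rw [← hι, ← this, ← (Coalgebra.Repr.arbitrary k a).eq]
  simp [hι]

/-- The coefficients of skew polynomials in a Hopf-Ore extension are `k`-linear. -/
theorem exists_coeff_linearMap (hH : IsHopfOreExtension σ g) (n : ℕ) :
    ∃ π : OreExtension σ →ₗ[k] A,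
    ∀ a m, π (C σ a * X σ ^ m) = if m = n then a else 0 := by
  refine ⟨{ coeffAddHom σ n with
    map_smul' := fun c p => ?_ }, fun a m => coeffAddHom_C_mul_X_pow σ n m a⟩
  -- Scalars act through A because the inclusion of A is `k`-linear, so left A-linearity of the
  -- coefficient suffices.
  have h : c • p = C σ (c • 1) * p := by
    rw [hH.C_smul, map_one, smul_mul_assoc, one_mul]
  change coeffAddHom σ n (c • p) = c • coeffAddHom σ n p
  rw [h, coeffAddHom_C_mul, smul_mul_assoc, one_mul]

/-- Compare the coefficients of x ⊗ 1 in Δ(x)Δ(a) = Δ(σ(a))Δ(x). This is what makes σ a winding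
automorphism given by χ. -/
theorem comul_apply (hH : IsHopfOreExtension σ g) (a : A) : Coalgebra.comul (R := k) (σ a) =
    σ.toLinearMap.rTensor A (Coalgebra.comul (R := k) a) := by
  obtain ⟨π₀, h₀⟩ := hH.exists_coeff_linearMap 0
  obtain ⟨π₁, h₁⟩ := hH.exists_coeff_linearMap 1
  have e00 : ∀ b, π₀ (C σ b) = b := fun b => by simpa using h₀ b 0
  have e01 : ∀ b, π₀ (C σ b * X σ) = 0 := fun b => by simpa using h₀ b 1
  have e10 : ∀ b, π₁ (C σ b) = 0 := fun b => by simpa using h₁ b 0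
  have e11 : ∀ b, π₁ (C σ b * X σ) = b := fun b => by simpa using h₁ b 1
  have h0 : Coalgebra.comul (R := k) (X σ) * Coalgebra.comul (R := k) (C σ a) =
      Coalgebra.comul (R := k) (C σ (σ a)) * Coalgebra.comul (R := k) (X σ) := by
    rw [← Bialgebra.comul_mul, ← Bialgebra.comul_mul, X_mul_C]
  have h := congrArg (TensorProduct.map π₁ π₀) h0
  simp only [hH.comul_X, hH.comul_C, add_mul, mul_add, Finset.mul_sum,
    Finset.sum_mul, Algebra.TensorProduct.tmul_mul_tmul, one_mul, mul_one, X_mul_C, ← map_mul,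
    map_add, map_sum, TensorProduct.map_tmul, e00, e01, e10, e11,
    TensorProduct.tmul_zero, Finset.sum_const_zero, add_zero] at h
  rw [← (Coalgebra.Repr.arbitrary k (σ a)).eq, ← h, ← (Coalgebra.Repr.arbitrary k a).eq]
  simp

theorem apply_eq_smul (hH : IsHopfOreExtension σ g) : σ g = oreCharacter σ g • g := by
  have h := Coalgebra.rTensor_counit_comul (R := k) (σ g)
  rw [hH.comul_apply, hH.isGroupLikeElem.comul_eq_tmul_self] at h
  simpa [oreCharacter_apply] using (congrArg (TensorProduct.lid k A) h).symm

theorem X_mul_C_grouplike (hH : IsHopfOreExtension σ g) :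
    X σ * C σ g = oreCharacter σ g • (C σ g * X σ) := by
  rw [X_mul_C, hH.apply_eq_smul, hH.C_smul, smul_mul_assoc]

theorem comul_X_pow (hH : IsHopfOreExtension σ g) {d : ℕ} (hd : 0 < d)
    (hq : IsPrimitiveRoot (oreCharacter σ g) d) : Coalgebra.comul (R := k) (X σ ^ d) =
    (X σ ^ d) ⊗ₜ[k] 1 + (C σ g ^ d) ⊗ₜ[k] (X σ ^ d) := by
  rw [Bialgebra.comul_pow, hH.comul_X, add_pow_eq_of_isPrimitiveRoot hd hq]
  · simp
  · simp only [Algebra.TensorProduct.tmul_mul_tmul, one_mul, mul_one, hH.X_mul_C_grouplike,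
      TensorProduct.smul_tmul']

theorem comul_X_pow_add_pow_sub_one (hH : IsHopfOreExtension σ g) {d : ℕ} (hd : 0 < d)
    (hq : IsPrimitiveRoot (oreCharacter σ g) d) :
    Coalgebra.comul (R := k) (X σ ^ d + C σ g ^ d - 1) =
      (X σ ^ d + C σ g ^ d - 1) ⊗ₜ[k] 1 + (C σ g ^ d) ⊗ₜ[k] (X σ ^ d + C σ g ^ d - 1) := by
  rw [map_sub, map_add, hH.comul_X_pow hd hq, hH.isGroupLikeElem_C.pow.comul_eq_tmul_self,
    Bialgebra.comul_one, Algebra.TensorProduct.one_def]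
  simp only [TensorProduct.add_tmul, TensorProduct.sub_tmul, TensorProduct.tmul_add,
    TensorProduct.tmul_sub]
  abel

theorem X_pow_add_pow_sub_one_mem_center (hH : IsHopfOreExtension σ g) {d : ℕ}
    (hq : IsPrimitiveRoot (oreCharacter σ g) d) (hg : g ^ d ∈ Set.center A)
    (hχ : WithConv.toConv (oreCharacter σ) ^ d = 1) :
    X σ ^ d + C σ g ^ d - 1 ∈ Set.center (OreExtension σ) := by
  have hXC : ∀ a, Commute (X σ ^ d) (C σ a) := fun a => by
    have := X_mul_C_pow σ a d
    rwa [pow_eq_one_of_toConv_oreCharacter_pow_eq_one hH.comul_apply hχ, AlgEquiv.one_apply] at this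
  have hGC : ∀ a, Commute (C σ g ^ d) (C σ a) := fun a => by
    have := congrArg (C σ) ((Set.mem_center_iff.mp hg).comm a)
    rwa [map_mul, map_mul, map_pow] at this
  have hGX : Commute (C σ g ^ d) (X σ) := by
    have := mul_pow_eq_smul_of_mul_eq_smul hH.X_mul_C_grouplike d
    rw [hq.pow_eq_one, one_smul] at this
    exact this.symm
  rw [Semigroup.mem_center_iff]
  intro p
  induction p using induction_on σ with
  | add p q hp hq => rw [add_mul, hp, hq, mul_add]
  | monomial a n =>
    have h1 : Commute (X σ ^ d + C σ g ^ d - 1) (C σ a) :=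
      ((hXC a).add_left (hGC a)).sub_left (Commute.one_left _)
    have h2 : Commute (X σ ^ d + C σ g ^ d - 1) (X σ) :=
      (((Commute.refl _).pow_left d).add_left hGX).sub_left (Commute.one_left _)
    exact (h1.mul_right (h2.pow_right n)).eq.symm

end IsHopfOreExtension

end HopfOre

/-! ### Partial actions of skew-primitive elements -/

namespace PartialAction

variable {k H R : Type*} [Field k] [Ring H] [Ring R] [Algebra k R]

section Bialgebra

variable [Bialgebra k H] (P : PartialAction k H R)

theorem act_act_of_isGroupLikeElem {g : H} (hg : IsGroupLikeElem k g) (l : H) (r : R) :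
    P.act g (P.act l r) = P.act g 1 * P.act (g * l) r := by
  rw [P.act_act, hg.comul_eq_tmul_self]; rfl

theorem act_mul_of_comul_eq {x a b c e : H}
    (hx : Coalgebra.comul (R := k) x = a ⊗ₜ[k] b + c ⊗ₜ[k] e) (r s : R) :
    P.act x (r * s) = P.act a r * P.act b s + P.act c r * P.act e s := by
  rw [P.act_mul, hx, map_add, map_add]; rfl

theorem act_act_of_comul_eq {x a b c e : H}
    (hx : Coalgebra.comul (R := k) x = a ⊗ₜ[k] b + c ⊗ₜ[k] e) (l : H) (r : R) :
    P.act x (P.act l r) = P.act a 1 * P.act (b * l) r + P.act c 1 * P.act (e * l) r := by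
  rw [P.act_act, hx, map_add, map_add]; rfl

theorem act_pow_one_of_isGroupLikeElem {g : H} (hg : IsGroupLikeElem k g)
    (h : P.act g 1 = 1) (n : ℕ) : P.act (g ^ n) 1 = 1 := by
  induction n with
  | zero => rw [pow_zero, P.one_act]
  | succ n ih =>
    have h1 := P.act_act_of_isGroupLikeElem hg (g ^ n) 1
    rwa [ih, h, one_mul, ← pow_succ', eq_comm] at h1

/-- In w · (l · r) = (w · 1)(l · r) + (g · 1)(w l · r), all but the last factor is known. -/
theorem act_mul_eq_zero_of_comul_eq {g w : H}
    (hw : Coalgebra.comul (R := k) w = w ⊗ₜ[k] 1 + g ⊗ₜ[k] w) (hg : P.act g 1 = 1)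
    (h : ∀ r, P.act w r = 0) (l : H) (r : R) : P.act (w * l) r = 0 := by
  have h1 := P.act_act_of_comul_eq hw l r
  rwa [h, h, zero_mul, zero_add, hg, one_mul, eq_comm] at h1

/-- A partial action that vanishes on a biideal descends to the quotient. -/
theorem existsUnique_quotient (I : Ideal H) [I.IsTwoSided] [(I.restrictScalars k).IsCoideal]
    (hI : ∀ h ∈ I, ∀ r : R, P.act h r = 0) : ∃! P' : PartialAction k (H ⧸ I) R,
      ∀ (h : H) (r : R), P'.act (Ideal.Quotient.mk I h) r = P.act h r := by
  let act : H ⧸ I →ₗ[k] R →ₗ[k] R :=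
    (I.restrictScalars k).liftQ P.act fun h hh => LinearMap.ext fun r => hI h hh r
  have hact : ∀ h : H, act (Ideal.Quotient.mk I h) = P.act h := fun _ => rfl
  have hflip : ∀ r, act.flip r ∘ₗ (Ideal.Quotient.mkₐ k I).toLinearMap = P.act.flip r :=
    fun _ => rfl
  have hmul : ∀ l, LinearMap.mulRight k (Ideal.Quotient.mk I l) ∘ₗ
      (Ideal.Quotient.mkₐ k I).toLinearMap =
      (Ideal.Quotient.mkₐ k I).toLinearMap ∘ₗ LinearMap.mulRight k l := by
    intro l
    ext h
    exact (map_mul (Ideal.Quotient.mk I) h l).symm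
  refine ⟨⟨act, P.one_act, ?_, ?_⟩, fun h r => by rw [hact], fun Q hQ => ?_⟩
  · intro h r s
    obtain ⟨h, rfl⟩ := Ideal.Quotient.mk_surjective h
    rw [hact, P.act_mul, Bialgebra.Quotient.comul_mk, ← LinearMap.comp_apply (TensorProduct.map _ _)
      (TensorProduct.map _ _), ← TensorProduct.map_comp, hflip, hflip]
  · intro h l r
    obtain ⟨h, rfl⟩ := Ideal.Quotient.mk_surjective h
    obtain ⟨l, rfl⟩ := Ideal.Quotient.mk_surjective l
    rw [hact, hact, P.act_act, Bialgebra.Quotient.comul_mk,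
      ← LinearMap.comp_apply (TensorProduct.map _ _) (TensorProduct.map _ _),
      ← TensorProduct.map_comp, hflip, LinearMap.comp_assoc, hmul, ← LinearMap.comp_assoc, hflip]
  · refine PartialAction.ext (LinearMap.ext fun h => LinearMap.ext fun r => ?_)
    obtain ⟨h, rfl⟩ := Ideal.Quotient.mk_surjective h
    rw [hQ, hact]

end Bialgebra

section HopfAlgebra

variable [HopfAlgebra k H] (P : PartialAction k H R) {g x : H}

/-- If `g · 1 = 0`, then a `(g, 1)`-skew-primitive element `x` acts by
`x m · r = y (m · r) - (g m · r) y`, where `y = x · 1`. -/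
theorem act_mul_add_act_mul_of_comul_eq (hg : IsGroupLikeElem k g)
    (hx : Coalgebra.comul (R := k) x = x ⊗ₜ[k] 1 + g ⊗ₜ[k] x) (hg0 : P.act g 1 = 0)
    (m : H) (r : R) :
    P.act (x * m) r + P.act (g * m) r * P.act x 1 = P.act x 1 * P.act m r := by
  set γ := HopfAlgebra.antipode k g
  have hγ : IsGroupLikeElem k γ := hg.antipode
  have hγg : γ * g = 1 := hg.antipode_mul_cancel
  have hgγ : g * γ = 1 := hg.mul_antipode_cancel
  have hγ0 : P.act γ 1 = 0 := by
    have h := P.act_act_of_isGroupLikeElem hγ g 1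
    rwa [hg0, map_zero, hγg, P.one_act, mul_one, eq_comm] at h
  -- Twisting x by γ = g⁻¹ moves the grouplike to the other tensor leg. As γ · 1 = 0, the element x
  -- γ then acts as right multiplication by (x γ) · 1, which equals -y.
  have hxγ : Coalgebra.comul (R := k) (x * γ) = (x * γ) ⊗ₜ[k] γ + 1 ⊗ₜ[k] (x * γ) := by
    rw [Bialgebra.comul_mul, hx, hγ.comul_eq_tmul_self, add_mul, Algebra.TensorProduct.tmul_mul_tmul,
      Algebra.TensorProduct.tmul_mul_tmul, one_mul, hgγ]
  have hxγ1 : ∀ s, P.act (x * γ) s = s * P.act (x * γ) 1 := fun s => by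
    conv_lhs => rw [← mul_one s, P.act_mul_of_comul_eq hxγ, hγ0, mul_zero, zero_add, P.one_act]
  have hz : P.act (x * γ) 1 = - P.act x 1 := by
    have h := P.act_act_of_comul_eq hxγ g 1
    rw [hg0, map_zero, mul_assoc, hγg, P.one_act, mul_one, mul_one, one_mul] at h
    exact eq_neg_of_add_eq_zero_left h.symm
  -- Acting by x γ on g m · r and cancelling γ g = 1 leaves x m · r - y (m · r).
  have h := P.act_act_of_comul_eq hxγ (g * m) r
  rw [hxγ1 (P.act (g * m) r), hz, mul_assoc x, ← mul_assoc γ, hγg, one_mul, P.one_act,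
    one_mul] at h
  rw [eq_add_of_sub_eq' (a := P.act (x * m) r) (by rw [sub_eq_add_neg, ← neg_mul, add_comm, ← h])]
  rw [mul_neg, neg_add_cancel_right]

/-- If `g · 1 = 0` and `x g = q g x` with `q` a primitive `d`-th root of unity, then
`xᵈ · r = yᵈ r - (gᵈ · r) yᵈ`, where `y = x · 1`. -/
theorem act_pow_add_act_pow_mul (hg : IsGroupLikeElem k g)
    (hx : Coalgebra.comul (R := k) x = x ⊗ₜ[k] 1 + g ⊗ₜ[k] x) (hg0 : P.act g 1 = 0)
    {q : k} (hxg : x * g = q • (g * x)) {d : ℕ} (hd : 0 < d) (hq : IsPrimitiveRoot q d) (r : R) :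
    P.act (x ^ d) r + P.act (g ^ d) r * P.act x 1 ^ d = P.act x 1 ^ d * r := by
  set y := P.act x 1 with hy
  -- The one-step relation, valid for all m, says that N + X and T agree on the function m ↦ m · r.
  -- Since T commutes with N + X, their powers agree there too, and N X = q X N lets the d-th power
  -- of N + X split.
  let X : Module.End k (H →ₗ[k] R) := LinearMap.lcomp k R (LinearMap.mulLeft k x)
  let N : Module.End k (H →ₗ[k] R) :=
    LinearMap.lcomp k R (LinearMap.mulLeft k g) ∘ₗ LinearMap.compRight k (LinearMap.mulRight k y)
  let T : Module.End k (H →ₗ[k] R) := LinearMap.compRight k (LinearMap.mulLeft k y)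
  have hX : ∀ f m, X f m = f (x * m) := fun _ _ => rfl
  have hN : ∀ f m, N f m = f (g * m) * y := fun _ _ => rfl
  have hT : ∀ f m, T f m = y * f m := fun _ _ => rfl
  have hNX : N * X = q • (X * N) := by
    ext f m
    simp only [Module.End.mul_apply, LinearMap.smul_apply, hX, hN]
    rw [← mul_assoc, hxg, smul_mul_assoc, map_smul, smul_mul_assoc, mul_assoc]
  have hTc : Commute (N + X) T := by
    ext f m
    simp only [Module.End.mul_apply, LinearMap.add_apply, hX, hN, hT, mul_add, mul_assoc]
  have hXn : ∀ n f m, (X ^ n) f m = f (x ^ n * m) := by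
    intro n
    induction n with
    | zero => simp
    | succ n ih => intro f m; rw [pow_succ, Module.End.mul_apply, ih, hX, ← mul_assoc, ← pow_succ']
  have hNn : ∀ n f m, (N ^ n) f m = f (g ^ n * m) * y ^ n := by
    intro n
    induction n with
    | zero => simp
    | succ n ih =>
      intro f m
      rw [pow_succ, Module.End.mul_apply, ih, hN, ← mul_assoc, ← pow_succ', mul_assoc, ← pow_succ']
  have hTn : ∀ n f m, (T ^ n) f m = y ^ n * f m := by
    intro n
    induction n with
    | zero => simp
    | succ n ih => intro f m; rw [pow_succ, Module.End.mul_apply, ih, hT, ← mul_assoc, ← pow_succ]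
  have h1 : (N + X) (P.act.flip r) = T (P.act.flip r) := by
    ext m
    rw [LinearMap.add_apply, LinearMap.add_apply, hN, hX, hT, add_comm]
    exact P.act_mul_add_act_mul_of_comul_eq hg hx hg0 m r
  have h2 : ∀ n, ((N + X) ^ n) (P.act.flip r) = (T ^ n) (P.act.flip r) := by
    intro n
    induction n with
    | zero => rfl
    | succ n ih =>
      rw [pow_succ, Module.End.mul_apply, h1, ← Module.End.mul_apply, (hTc.pow_left n).eq,
        Module.End.mul_apply, ih, pow_succ', Module.End.mul_apply]
  have h3 := LinearMap.congr_fun (h2 d) 1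
  have h4 : (N + X) ^ d = N ^ d + X ^ d :=
    add_pow_eq_of_isPrimitiveRoot (B := Module.End k (H →ₗ[k] R)) hd hq hNX
  rw [h4, LinearMap.add_apply, LinearMap.add_apply, hXn, hNn,
    hTn, mul_one, mul_one, add_comm] at h3
  simpa only [LinearMap.flip_apply, P.one_act] using h3

end HopfAlgebra

end PartialAction

theorem mainTheorem7 {k A R : Type*} [Field k] [IsAlgClosed k] [CharZero k]
    [Ring A] [HopfAlgebra k A] [Ring R] [Algebra k R]
    (σ : A ≃ₐ[k] A) (g : A) [HopfAlgebra k (OreExtension σ)] (hH : IsHopfOreExtension σ g)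
    (d : ℕ) (hd : 0 < d)
    (hq : IsPrimitiveRoot (oreCharacter σ g) d)
    (hg : g ^ d ∈ Set.center A)
    (hχ : WithConv.toConv (oreCharacter σ) ^ d = 1)
    (P : PartialAction k (OreExtension σ) R)
    (hP : (P.act (OreExtension.C σ g) 1 = 1 ∧
        ∀ r : R, P.act (OreExtension.X σ ^ d + OreExtension.C σ g ^ d) r = r) ∨
      (P.act (OreExtension.C σ g) 1 = 0 ∧ P.act (OreExtension.C σ g ^ d) 1 = 1 ∧
        ∀ r : R, (P.act (OreExtension.X σ) 1 ^ d - 1) * r =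
          P.act (OreExtension.C σ g ^ d) r * (P.act (OreExtension.X σ) 1 ^ d - 1)))
    (I : Ideal (OreExtension σ)) [I.IsTwoSided]
    (hI : I.toTwoSided =
      TwoSidedIdeal.span {OreExtension.X σ ^ d + OreExtension.C σ g ^ d - 1}) :
    (∀ h ∈ I, ∀ r : R, P.act h r = 0) ∧
      ∃ _ : I.IsHopfIdeal k, ∃! P' : PartialAction k (OreExtension σ ⧸ I) R,
        ∀ (h : OreExtension σ) (r : R), P'.act (Ideal.Quotient.mk I h) r = P.act h r := by
  have hG : IsGroupLikeElem k (OreExtension.C σ g) := hH.isGroupLikeElem_C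
  have hw := hH.comul_X_pow_add_pow_sub_one hd hq
  have hmem : ∀ h, h ∈ I ↔ h ∈ TwoSidedIdeal.span
      {OreExtension.X σ ^ d + OreExtension.C σ g ^ d - 1} := fun h => by
    rw [← hI, Ideal.mem_toTwoSided]
  have hIc : ∀ h ∈ I, ∃ c, h = (OreExtension.X σ ^ d + OreExtension.C σ g ^ d - 1) * c :=
    fun h hh => exists_eq_mul_of_mem_span_singleton
      (hH.X_pow_add_pow_sub_one_mem_center hq hg hχ) ((hmem h).mp hh)
  have hHopf : I.IsHopfIdeal k := isHopfIdeal_of_forall_exists_mul hG.pow hw I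
    ((hmem _).mpr (TwoSidedIdeal.subset_span rfl)) hIc
  have hgd : P.act (OreExtension.C σ g ^ d) 1 = 1 := by
    rcases hP with ⟨h, -⟩ | ⟨-, h, -⟩
    · exact P.act_pow_one_of_isGroupLikeElem hG h d
    · exact h
  have hw0 : ∀ r, P.act (OreExtension.X σ ^ d + OreExtension.C σ g ^ d - 1) r = 0 := by
    intro r
    rw [map_sub, LinearMap.sub_apply, P.one_act, sub_eq_zero]
    rcases hP with ⟨-, h⟩ | ⟨h0, -, h⟩
    · exact h r
    · have h1 := P.act_pow_add_act_pow_mul hG hH.comul_X h0 hH.X_mul_C_grouplike hd hq r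
      have h2 := h r
      -- Substituting yᵈ r from `h1` cancels (gᵈ · r) yᵈ on both sides, leaving xᵈ · r - r = -(gᵈ ·
      -- r).
      rw [sub_mul, one_mul, mul_sub, mul_one, ← h1, add_sub_right_comm, add_comm, ← sub_eq_zero,
        add_sub_assoc] at h2
      rw [map_add, LinearMap.add_apply, ← sub_eq_zero, ← h2]
      abel
  have hI0 : ∀ h ∈ I, ∀ r : R, P.act h r = 0 := fun h hh r => by
    obtain ⟨c, rfl⟩ := hIc h hh
    exact P.act_mul_eq_zero_of_comul_eq hw hgd hw0 c r
  exact ⟨hI0, hHopf, P.existsUnique_quotient I hI0⟩
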